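/- Consider a simple point process on the line, i.e. a random locally finite set $S\subset\mathbb{R}$ of event epochs, and write $N(B)=\#(S\cap B)$. Suppose that it is time-stationary (its law $P^{\pi}$ is invariant under all shifts of time), non-transient (almost surely there are events arbitrarily far in both directions of time), and has finite intensity $\lambda^*=\mathbb{E}^{\pi}[N(0,1]]<\infty$. Let $P^{\alpha}$ be its event-stationary version, that is, its Palm distribution $$P^{\alpha}(A)=\frac{1}{\lambda^*}\,\mathbb{E}^{\pi}\big[\#\{t\in S\cap(0,1] : S-t\in A\}\big].$$ Let $T_1=\inf\{t>0 : t\in S\}$, and write $T_1^{\pi}$ and $T_1^{\alpha}$ for $T_1$ under $P^{\pi}$ and $P^{\alpha}$ respectively. Then $0<\mathbb{E}[T_1^{\alpha}]<\infty$, so that $$c^2=\frac{\mathrm{Var}(T_1^{\alpha})}{(\mathbb{E}[T_1^{\alpha}])^2}\in[0,\infty]$$ is well defined, and $$c^2\ge 1\quad\Longleftrightarrow\quad \mathbb{E}[T_1^{\pi}]\ge\mathbb{E}[T_1^{\alpha}],$$ where $\mathrm{Var}(T_1^{\alpha})$ and $\mathbb{E}[T_1^{\pi}]$ may be infinite. In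 particular, if $T_1^{\pi}\ge_{\mathrm{st}}T_1^{\alpha}$, i.e. $\mathbb{P}(T_1^{\pi}>t)\ge\mathbb{P}(T_1^{\alpha}>t)$ for all real $t$, then $c^2\ge 1$. -/

import Mathlib

open MeasureTheory ProbabilityTheory Set
open scoped ENNReal

noncomputable section

/-- A locally finite subset of the line: a realization of a simple point process. -/
@[ext] structure PointConfig where
  /-- The set of event epochs. -/
  points : Set ℝ
  locallyFinite : ∀ a b : ℝ, (points ∩ Icc a b).Finite

namespace PointConfig

/-- The counting measure `N` of a configuration: `N B` is the number of events in `B`. -/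
def count (S : PointConfig) : Measure ℝ := Measure.count.restrict S.points

/-- The usual σ-algebra on configurations, generated by the counts `S ↦ N B`, `B` Borel. -/
instance : MeasurableSpace PointConfig := MeasurableSpace.comap count inferInstance

/-- The configuration seen from `t`: the origin is moved to `t`. -/
def shift (t : ℝ) (S : PointConfig) : PointConfig where
  points := {s | s + t ∈ S.points}
  locallyFinite a b := by
    refine ((S.locallyFinite (a + t) (b + t)).preimage
      (add_left_injective t).injOn).subset ?_
    rintro s ⟨hs, h1, h2⟩
    exact ⟨hs, by simpa using h1, by simpa using h2⟩

/-- `T₁`, the first event epoch after the origin. When the origin itself is an event, this is the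
length of the inter-event interval that starts there. -/
def firstEvent (S : PointConfig) : ℝ := sInf {t | 0 < t ∧ t ∈ S.points}

end PointConfig

/-- Time-stationarity of the law `P` of a point process: `P` is invariant under time shifts. -/
def IsTimeStationary (P : Measure PointConfig) : Prop :=
  ∀ t : ℝ, P.map (PointConfig.shift t) = P

/-- Non-transience: almost surely the events do not die out, in either direction of time. -/
def IsNonTransient (P : Measure PointConfig) : Prop :=
  ∀ᵐ S ∂P, ¬ BddAbove S.points ∧ ¬ BddBelow S.points

/-- The intensity (rate) `λ* = E[N(0,1]]`. -/
def intensity (P : Measure PointConfig) : ℝ≥0∞ := ∫⁻ S, S.count (Ioc 0 1) ∂P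

/-- The event-stationary version of a time-stationary point process with law `P`, that is, its
Palm distribution: `A ↦ (1/λ*) E[#{t ∈ S ∩ (0,1] : S seen from t lies in A}]`
(see `eventStationary_apply`). -/
def eventStationary (P : Measure PointConfig) : Measure PointConfig :=
  (intensity P)⁻¹ • P.bind fun S => (S.count.restrict (Ioc 0 1)).map fun t => S.shift t

/-- The expectation of `T₁` under the law `P`, in `[0,∞]`. -/
def meanFirst (P : Measure PointConfig) : ℝ≥0∞ := ∫⁻ S, ENNReal.ofReal S.firstEvent ∂P

/-- The squared coefficient of variation `Var(T₁) / E[T₁]²` of `T₁` under the law `P`, in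
`[0,∞]`. -/
def scvFirst (P : Measure PointConfig) : ℝ≥0∞ :=
  evariance PointConfig.firstEvent P / (meanFirst P) ^ 2

/-- The stochastic order: `T₁` under `P` is stochastically at least as large as `T₁` under `Q`. -/
def FirstStochasticallyDominates (P Q : Measure PointConfig) : Prop :=
  ∀ t : ℝ, Q {S | t < S.firstEvent} ≤ P {S | t < S.firstEvent}

/-! Measurability facts, which show that the maps used above are not junk. -/

namespace PointConfig

theorem measurable_count : Measurable count := comap_measurable _

theorem count_Icc_lt_top (S : PointConfig) (a b : ℝ) : S.count (Icc a b) < ∞ := by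
  rw [count, Measure.restrict_apply measurableSet_Icc, Set.inter_comm]
  exact Measure.count_apply_lt_top.2 (S.locallyFinite a b)

theorem countable_points (S : PointConfig) : S.points.Countable := by
  have h : S.points = ⋃ n : ℕ, S.points ∩ Icc (-(n : ℝ)) n := by
    ext x
    simp only [mem_iUnion, mem_inter_iff, mem_Icc, exists_and_left]
    refine ⟨fun hx => ⟨hx, ?_⟩, fun hx => hx.1⟩
    obtain ⟨n, hn⟩ := exists_nat_ge |x|
    exact ⟨n, abs_le.1 hn⟩
  rw [h]
  exact countable_iUnion fun n => (S.locallyFinite _ _).countable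

theorem count_shift (t : ℝ) (S : PointConfig) :
    (S.shift t).count = S.count.map fun s => s - t := by
  ext B hB
  have hm : Measurable fun s : ℝ => s - t := measurable_id.sub_const t
  rw [Measure.map_apply hm hB, count, count, Measure.restrict_apply hB,
    Measure.restrict_apply (hm hB),
    Measure.count_apply (hB.inter (S.shift t).countable_points.measurableSet),
    Measure.count_apply ((hm hB).inter S.countable_points.measurableSet)]
  have h : (fun s : ℝ => s - t) ⁻¹' B ∩ S.points
      = (fun s : ℝ => s + t) '' (B ∩ (S.shift t).points) := by
    ext x
    constructor
    · rintro ⟨h1, h2⟩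
      exact ⟨x - t, ⟨h1, by simpa [shift] using h2⟩, by simp⟩
    · rintro ⟨y, ⟨h1, h2⟩, rfl⟩
      exact ⟨by simpa using h1, h2⟩
  rw [h, (add_left_injective t).encard_image]

/-- Counting the events in `(n, n+1]`, when there are exactly `k` of them. -/
def countPiece (p : ℤ × ℕ) (S : PointConfig) : Measure ℝ :=
  {S : PointConfig | S.count (Ioc (p.1 : ℝ) (p.1 + 1)) = p.2}.indicator
    (fun S => S.count.restrict (Ioc (p.1 : ℝ) (p.1 + 1))) S

theorem count_Ioc_lt_top (S : PointConfig) (a b : ℝ) : S.count (Ioc a b) < ∞ :=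
  (measure_mono Ioc_subset_Icc_self).trans_lt (S.count_Icc_lt_top a b)

theorem exists_count_Ioc (S : PointConfig) (a b : ℝ) : ∃ k : ℕ, S.count (Ioc a b) = k := by
  have h := S.count_Ioc_lt_top a b
  have hm := (measurableSet_Ioc (a := a) (b := b)).inter S.countable_points.measurableSet
  rw [count, Measure.restrict_apply measurableSet_Ioc] at h ⊢
  exact ⟨_, Measure.count_apply_finite' (Measure.count_apply_lt_top.1 h) hm⟩

theorem measurable_count_apply {B : Set ℝ} (hB : MeasurableSet B) :
    Measurable fun S : PointConfig => S.count B :=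
  (Measure.measurable_coe hB).comp measurable_count

theorem measurable_countPiece (p : ℤ × ℕ) : Measurable (countPiece p) := by
  refine Measurable.indicator ?_ (measurable_count_apply measurableSet_Ioc
    (measurableSet_singleton _))
  refine Measure.measurable_of_measurable_coe _ fun B hB => ?_
  simp_rw [Measure.restrict_apply hB]
  exact measurable_count_apply (hB.inter measurableSet_Ioc)

/-- `countPiece` as a kernel. -/
def pieceKernel (p : ℤ × ℕ) : Kernel PointConfig ℝ := ⟨countPiece p, measurable_countPiece p⟩

instance (p : ℤ × ℕ) : IsFiniteKernel (pieceKernel p) := by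
  refine ⟨⟨p.2, ENNReal.natCast_lt_top _, fun S => ?_⟩⟩
  change countPiece p S univ ≤ p.2
  unfold countPiece
  by_cases h : S.count (Ioc (p.1 : ℝ) (p.1 + 1)) = p.2
  · rw [indicator_of_mem (by exact h)]
    simp [h]
  · rw [indicator_of_notMem (by exact h)]
    simp

/-- `count` as a kernel. -/
def countKernel : Kernel PointConfig ℝ := ⟨count, measurable_count⟩

theorem countKernel_eq_sum : countKernel = Kernel.sum pieceKernel := by
  ext S B hB
  rw [Kernel.sum_apply, Measure.sum_apply _ hB,
    ENNReal.tsum_prod (f := fun n k => pieceKernel (n, k) S B)]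
  have h1 : ∀ n : ℤ, ∑' k : ℕ, pieceKernel (n, k) S B
      = S.count (B ∩ Ioc (n : ℝ) (n + 1)) := by
    intro n
    obtain ⟨k, hk⟩ := S.exists_count_Ioc n (n + 1)
    rw [tsum_eq_single k]
    · change countPiece (n, k) S B = _
      rw [countPiece, indicator_of_mem (by exact hk), Measure.restrict_apply hB]
    · intro j hj
      change countPiece (n, j) S B = _
      rw [countPiece, indicator_of_notMem]
      · simp
      · intro h
        simp only [mem_ofPred_eq] at h
        rw [hk] at h
        exact hj (by exact_mod_cast h.symm)
  simp_rw [h1]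
  have hd : Pairwise (Function.onFun Disjoint fun n : ℤ => B ∩ Ioc (n : ℝ) (n + 1)) :=
    fun i j hij => ((pairwise_disjoint_Ioc_intCast ℝ) hij).mono inter_subset_right
      inter_subset_right
  rw [← measure_iUnion hd fun n => hB.inter measurableSet_Ioc, ← inter_iUnion,
    iUnion_Ioc_intCast, inter_univ]
  rfl

instance : IsSFiniteKernel countKernel := by
  rw [countKernel_eq_sum]; infer_instance

theorem measurable_shift_uncurry :
    Measurable fun p : PointConfig × ℝ => p.1.shift p.2 := by
  refine measurable_comap_iff.2 (Measure.measurable_of_measurable_coe _ fun B hB => ?_)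
  have hf : Measurable (Prod.fst : PointConfig × ℝ → PointConfig) := measurable_fst
  have h : ∀ p : PointConfig × ℝ, (count ∘ fun p : PointConfig × ℝ => p.1.shift p.2) p B
      = ∫⁻ s, B.indicator (fun _ => 1) (s - p.2)
        ∂(countKernel.comap Prod.fst hf) p := by
    intro p
    simp only [Function.comp, count_shift, Kernel.comap_apply]
    have hm : Measurable fun s : ℝ => s - p.2 := measurable_id.sub_const _
    rw [← lintegral_indicator_one hB, lintegral_map (measurable_one.indicator hB) hm]
    rfl
  simp_rw [h]
  refine Measurable.lintegral_kernel_prod_right' (f := fun q : (PointConfig × ℝ) × ℝ =>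
    B.indicator (fun _ => (1 : ℝ≥0∞)) (q.2 - q.1.2)) ?_
  exact (measurable_const.indicator hB).comp (measurable_snd.sub (measurable_snd.comp
    measurable_fst))

theorem measurable_shift (t : ℝ) : Measurable (shift t) :=
  measurable_shift_uncurry.comp (measurable_id.prodMk measurable_const)

theorem measurable_shift_left (S : PointConfig) : Measurable fun t => S.shift t :=
  measurable_shift_uncurry.comp (measurable_const.prodMk measurable_id)

theorem measurable_seen : Measurable fun S : PointConfig =>
    (S.count.restrict (Ioc 0 1)).map fun t => S.shift t := by
  refine Measure.measurable_of_measurable_coe _ fun A hA => ?_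
  have h : ∀ S : PointConfig, ((S.count.restrict (Ioc 0 1)).map fun t => S.shift t) A
      = ∫⁻ t, ((fun p : PointConfig × ℝ => p.1.shift p.2) ⁻¹' A ∩
          Prod.snd ⁻¹' Ioc 0 1).indicator (fun _ => 1) (S, t) ∂countKernel S := by
    intro S
    have hS := S.measurable_shift_left hA
    rw [Measure.map_apply S.measurable_shift_left hA, Measure.restrict_apply hS,
      ← lintegral_indicator_one (hS.inter measurableSet_Ioc)]
    rfl
  simp_rw [h]
  refine Measurable.lintegral_kernel_prod_right' (κ := countKernel) ?_
  exact measurable_const.indicator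
    ((measurable_shift_uncurry hA).inter (measurable_snd measurableSet_Ioc))

end PointConfig

theorem eventStationary_apply (P : Measure PointConfig) {A : Set PointConfig}
    (hA : MeasurableSet A) :
    eventStationary P A = (intensity P)⁻¹ *
      ∫⁻ S, ({t | t ∈ S.points ∧ t ∈ Ioc 0 1 ∧ S.shift t ∈ A}.encard : ℝ≥0∞) ∂P := by
  rw [eventStationary, Measure.smul_apply, smul_eq_mul,
    Measure.bind_apply hA PointConfig.measurable_seen.aemeasurable]
  congr 1
  refine lintegral_congr fun S => ?_
  have hS := S.measurable_shift_left hA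
  rw [Measure.map_apply S.measurable_shift_left hA, Measure.restrict_apply hS,
    PointConfig.count, Measure.restrict_apply (hS.inter measurableSet_Ioc),
    Measure.count_apply ((hS.inter measurableSet_Ioc).inter S.countable_points.measurableSet)]
  congr 2
  ext t
  simp only [mem_inter_iff, mem_preimage, mem_ofPred_eq]
  tauto

end

namespace PointConfig

/-! The proof is a mass-transport argument. Each event `t` spreads mass over the inter-event
interval starting at `t`, with density `φ` of the time left until the next event. A point `x`
receives only from the last event at or before it, and gets `φ (S.waiting x)`; the event sends out
`∫ φ` over `(0, S.waiting t]`. By stationarity the mean mass from block `(i, i+1]` to block `(j,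
j+1]` depends only on `j - i`, so a unit block receives on average what it sends. This is the
inversion formula `lintegral_firstEvent_eq`.

Write `T` for the first event, `π` for the stationary law and `α` for the Palm law. Taking `φ = 1`
gives `E[T^α] = 1/λ*`, and `φ y = y` gives `E[(T^α)²] = 2 E[T^α] E[T^π]`. Now `c² ≥ 1` says
`E[(T^α)²] ≥ 2 E[T^α]²`, and cancelling `2 E[T^α]`, which is positive and finite, leaves `E[T^π] ≥
E[T^α]`. -/

instance (S : PointConfig) : SFinite S.count :=
  inferInstanceAs (SFinite (countKernel S))

/-! ### First event, waiting times and last event -/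

theorem firstEvent_nonneg (S : PointConfig) : 0 ≤ S.firstEvent :=
  Real.sInf_nonneg fun _ h => h.1.le

theorem firstEvent_isLeast {S : PointConfig} (h : {t | 0 < t ∧ t ∈ S.points}.Nonempty) :
    IsLeast {t | 0 < t ∧ t ∈ S.points} S.firstEvent := by
  obtain ⟨b, hb0, hb⟩ := h
  have hf : ({t | 0 < t ∧ t ∈ S.points} ∩ Icc 0 b).Finite :=
    (S.locallyFinite 0 b).subset fun t ht => ⟨ht.1.2, ht.2⟩
  obtain ⟨m, hm, hmin⟩ := Set.exists_min_image _ id hf ⟨b, ⟨hb0, hb⟩, hb0.le, le_rfl⟩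
  have hl : IsLeast {t | 0 < t ∧ t ∈ S.points} m := by
    refine ⟨hm.1, fun t ht => ?_⟩
    rcases le_total t b with h | h
    · exact hmin t ⟨ht, ht.1.le, h⟩
    · exact hm.2.2.trans h
  have : S.firstEvent = m := hl.csInf_eq
  rwa [this]

theorem count_eq_zero_iff (S : PointConfig) {B : Set ℝ} (hB : MeasurableSet B) :
    S.count B = 0 ↔ ∀ t ∈ B, t ∉ S.points := by
  rw [count, Measure.restrict_apply hB, Measure.count_eq_zero_iff,
    Set.eq_empty_iff_forall_notMem]
  simp

theorem measurable_firstEvent : Measurable firstEvent := by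
  refine measurable_of_Iio fun c => ?_
  rcases le_or_gt c 0 with hc | hc
  · have : firstEvent ⁻¹' Iio c = ∅ := by
      ext S
      simpa using hc.trans S.firstEvent_nonneg
    rw [this]
    exact .empty
  -- The second set is there because `sInf ∅ = 0 < c` when no event follows the origin.
  · have : firstEvent ⁻¹' Iio c
        = {S | S.count (Ioo 0 c) = 0}ᶜ ∪ {S | S.count (Ioi 0) = 0} := by
      ext S
      simp only [mem_preimage, mem_Iio, mem_union, mem_compl_iff, mem_ofPred_eq,
        S.count_eq_zero_iff measurableSet_Ioo, S.count_eq_zero_iff measurableSet_Ioi]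
      by_cases h : {t | 0 < t ∧ t ∈ S.points}.Nonempty
      · have hl := firstEvent_isLeast h
        constructor
        · exact fun hlt => Or.inl fun H => H _ ⟨hl.1.1, hlt⟩ hl.1.2
        · rintro (H | H)
          · push Not at H
            obtain ⟨t, ht, hS⟩ := H
            exact (hl.2 ⟨ht.1, hS⟩).trans_lt ht.2
          · exact absurd hl.1.2 (H _ hl.1.1)
      · have h0 : S.firstEvent = 0 := by
          rw [firstEvent, Set.not_nonempty_iff_eq_empty.1 h, Real.sInf_empty]
        rw [h0]
        refine ⟨fun _ => Or.inr fun t ht hS => h ⟨t, ht, hS⟩, fun _ => hc⟩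
    rw [this]
    exact ((measurable_count_apply measurableSet_Ioo (measurableSet_singleton 0)).compl).union
      (measurable_count_apply measurableSet_Ioi (measurableSet_singleton 0))

theorem shift_shift (s t : ℝ) (S : PointConfig) : (S.shift s).shift t = S.shift (t + s) := by
  ext x
  simp [shift, add_assoc]

/-- The waiting time from `t` to the first event after `t`. -/
noncomputable def waiting (S : PointConfig) (t : ℝ) : ℝ := (S.shift t).firstEvent

theorem waiting_shift (s t : ℝ) (S : PointConfig) :
    (S.shift s).waiting t = S.waiting (t + s) := by
  rw [waiting, waiting, shift_shift]

theorem measurable_waiting : Measurable fun p : PointConfig × ℝ => p.1.waiting p.2 :=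
  measurable_firstEvent.comp measurable_shift_uncurry

theorem waiting_isLeast {S : PointConfig} (h : ¬ BddAbove S.points) (x : ℝ) :
    IsLeast {t | 0 < t ∧ t + x ∈ S.points} (S.waiting x) := by
  refine firstEvent_isLeast (S := S.shift x) ?_
  obtain ⟨y, hy, hxy⟩ := not_bddAbove_iff.1 h x
  exact ⟨y - x, sub_pos.2 hxy, by simpa [shift] using hy⟩

theorem exists_lastEvent {S : PointConfig} (h : ¬ BddBelow S.points) (x : ℝ) :
    ∃ t, IsGreatest (S.points ∩ Iic x) t := by
  obtain ⟨y, hy, hxy⟩ := not_bddBelow_iff.1 h x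
  obtain ⟨m, hm, hmax⟩ := Set.exists_max_image _ id (S.locallyFinite y x) ⟨y, hy, le_rfl, hxy.le⟩
  refine ⟨m, ⟨hm.1, hm.2.2⟩, fun t ht => ?_⟩
  rcases le_total y t with h | h
  · exact hmax t ⟨ht.1, h, ht.2⟩
  · exact h.trans hm.2.1

/-! ### Mass transport and the inversion formula -/

/-- The mass `φ (remaining time)` sent from the event `t` to a point `x` of the inter-event
interval that starts at `t`. -/
noncomputable def transport (φ : ℝ → ℝ≥0∞) (S : PointConfig) (t x : ℝ) : ℝ≥0∞ :=
  (Ico t (t + S.waiting t)).indicator (fun x => φ (t + S.waiting t - x)) x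

theorem measurable_transport {φ : ℝ → ℝ≥0∞} (hφ : Measurable φ) :
    Measurable fun p : (PointConfig × ℝ) × ℝ => transport φ p.1.1 p.1.2 p.2 := by
  have hw : Measurable fun p : (PointConfig × ℝ) × ℝ => p.1.2 + p.1.1.waiting p.1.2 :=
    (measurable_snd.comp measurable_fst).add (measurable_waiting.comp measurable_fst)
  have hs : MeasurableSet {p : (PointConfig × ℝ) × ℝ |
      p.1.2 ≤ p.2 ∧ p.2 < p.1.2 + p.1.1.waiting p.1.2} :=
    (measurableSet_le (measurable_snd.comp measurable_fst) measurable_snd).inter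
      (measurableSet_lt measurable_snd hw)
  exact (hφ.comp (hw.sub measurable_snd)).indicator hs

theorem transport_shift (φ : ℝ → ℝ≥0∞) (S : PointConfig) (s t x : ℝ) :
    transport φ (S.shift s) t x = transport φ S (t + s) (x + s) := by
  have h : x + s ∈ Ico (t + s) (t + s + S.waiting (t + s)) ↔
      x ∈ Ico t (t + S.waiting (t + s)) := by
    simp only [mem_Ico]
    constructor <;> rintro ⟨h1, h2⟩ <;> constructor <;> linarith
  unfold transport
  rw [waiting_shift]
  by_cases hx : x ∈ Ico t (t + S.waiting (t + s))
  · rw [indicator_of_mem hx, indicator_of_mem (h.2 hx)]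
    congr 1
    ring
  · rw [indicator_of_notMem hx, indicator_of_notMem (mt h.1 hx)]

/-- Exactly one event sends mass to `x`. -/
theorem lintegral_transport_left (φ : ℝ → ℝ≥0∞) {S : PointConfig}
    (ha : ¬ BddAbove S.points) (hb : ¬ BddBelow S.points) (x : ℝ) :
    ∫⁻ t, transport φ S t x ∂S.count = φ (S.waiting x) := by
  -- The sender is the last event at or before `x`; an event at `x` itself counts, as the intervals
  -- are closed on the left.
  obtain ⟨t₀, ⟨ht₀, htx⟩, hmax⟩ := exists_lastEvent hb x
  rw [mem_Iic] at htx
  have hwx := waiting_isLeast ha x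
  have hpos : 0 < S.waiting x := hwx.1.1
  have key : ∀ t ∈ S.points, transport φ S t x
      = ({t₀} : Set ℝ).indicator (fun _ => φ (S.waiting x)) t := by
    intro t ht
    have hwt := waiting_isLeast ha t
    by_cases h : t = t₀
    · subst h
      have h1 : S.waiting t ≤ S.waiting x + (x - t) :=
        hwt.2 ⟨by linarith, by
          have : S.waiting x + (x - t) + t = S.waiting x + x := by ring
          rw [this]; exact hwx.1.2⟩
      have h2 : x < t + S.waiting t := by
        by_contra! hle
        have := hmax ⟨hwt.1.2, by rw [mem_Iic]; linarith⟩
        linarith [hwt.1.1]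
      have h3 : S.waiting x ≤ t + S.waiting t - x :=
        hwx.2 ⟨by linarith, by
          have : t + S.waiting t - x + x = S.waiting t + t := by ring
          rw [this]; exact hwt.1.2⟩
      rw [transport, indicator_of_mem (by exact ⟨htx, h2⟩),
        indicator_of_mem (mem_singleton _)]
      congr 1
      linarith
    -- The interval of an earlier event ends no later than `t₀ ≤ x`.
    · rw [indicator_of_notMem (by exact h), transport, indicator_of_notMem]
      rintro ⟨h1, h2⟩
      have hlt : t < t₀ := lt_of_le_of_ne (hmax ⟨ht, h1⟩) h
      have : S.waiting t ≤ t₀ - t := hwt.2 ⟨by linarith, by simpa using ht₀⟩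
      linarith
  have hm := S.countable_points.measurableSet
  have hc : ∫⁻ t, transport φ S t x ∂S.count
      = ∫⁻ t, ({t₀} : Set ℝ).indicator (fun _ => φ (S.waiting x)) t ∂S.count :=
    setLIntegral_congr_fun hm key
  rw [hc, lintegral_indicator_const (measurableSet_singleton _), count,
    Measure.restrict_apply (measurableSet_singleton _),
    inter_eq_left.2 (singleton_subset_iff.2 ht₀), Measure.count_singleton, mul_one]

theorem lintegral_transport_right (φ : ℝ → ℝ≥0∞) (S : PointConfig) (t : ℝ) :
    ∫⁻ x, transport φ S t x = ∫⁻ y in Ioc 0 (S.waiting t), φ y := by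
  unfold transport
  -- Reflection `x = t + S.waiting t - y` turns position into remaining time.
  rw [← lintegral_sub_left_eq_self (μ := volume) _ (t + S.waiting t),
    ← lintegral_indicator measurableSet_Ioc]
  refine lintegral_congr fun y => ?_
  have h : t + S.waiting t - y ∈ Ico t (t + S.waiting t) ↔ y ∈ Ioc 0 (S.waiting t) := by
    simp only [mem_Ico, mem_Ioc]
    constructor <;> rintro ⟨h1, h2⟩ <;> constructor <;> linarith
  by_cases hy : y ∈ Ioc 0 (S.waiting t)
  · rw [indicator_of_mem hy, indicator_of_mem (h.2 hy), sub_sub_cancel]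
  · rw [indicator_of_notMem hy, indicator_of_notMem (mt h.1 hy)]

/-- The mean mass sent from events in `(i, i + 1]` to points of `(j, j + 1]`. -/
noncomputable def meanTransport (P : Measure PointConfig) (φ : ℝ → ℝ≥0∞) (i j : ℤ) : ℝ≥0∞ :=
  ∫⁻ S, ∫⁻ t in Ioc (i : ℝ) (i + 1),
    (∫⁻ x in Ioc (j : ℝ) (j + 1), transport φ S t x) ∂S.count ∂P

theorem measurable_setLIntegral_count {f : PointConfig × ℝ → ℝ≥0∞} (hf : Measurable f)
    {B : Set ℝ} (hB : MeasurableSet B) :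
    Measurable fun S : PointConfig => ∫⁻ t in B, f (S, t) ∂S.count := by
  simp_rw [← lintegral_indicator hB]
  exact Measurable.lintegral_kernel_prod_right' (κ := countKernel)
    (f := (Prod.snd ⁻¹' B).indicator f) (hf.indicator (measurable_snd hB))

theorem measurable_setLIntegral_transport {φ : ℝ → ℝ≥0∞} (hφ : Measurable φ) (A : Set ℝ) :
    Measurable fun p : PointConfig × ℝ => ∫⁻ x in A, transport φ p.1 p.2 x :=
  (measurable_transport hφ).lintegral_prod_right'

theorem setLIntegral_Ioc_add_right (μ : Measure ℝ) (f : ℝ → ℝ≥0∞) (hf : Measurable f)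
    (a b s : ℝ) :
    ∫⁻ t in Ioc a b, f (t + s) ∂(μ.map fun t => t - s) = ∫⁻ t in Ioc (a + s) (b + s), f t ∂μ := by
  have h1 : Measurable fun t : ℝ => t + s := measurable_id.add_const s
  have h2 : Measurable fun t : ℝ => t - s := measurable_id.sub_const s
  rw [setLIntegral_map (f := fun t => f (t + s)) measurableSet_Ioc (hf.comp h1) h2]
  simp

/-- Shifting the configuration moves senders and receivers together (`transport_shift`), and
stationarity leaves the mean unchanged. -/
theorem meanTransport_add {P : Measure PointConfig} (hP : IsTimeStationary P)
    {φ : ℝ → ℝ≥0∞} (hφ : Measurable φ) (i j n : ℤ) :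
    meanTransport P φ (i + n) (j + n) = meanTransport P φ i j := by
  have hx : ∀ (S : PointConfig) (t : ℝ),
      ∫⁻ x in Ioc (j : ℝ) (j + 1), transport φ (S.shift n) t x
        = ∫⁻ x in Ioc (j + n : ℝ) (j + 1 + n), transport φ S (t + n) x := by
    intro S t
    simp_rw [transport_shift]
    have hm : Measurable fun x => transport φ S (t + n) x :=
      (measurable_transport hφ).comp (measurable_const (a := (S, t + (n : ℝ))) |>.prodMk
        measurable_id)
    rw [← setLIntegral_Ioc_add_right volume _ hm,
      (measurePreserving_sub_right volume (n : ℝ)).map_eq]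
  symm
  conv_lhs => rw [meanTransport, ← hP n]
  rw [lintegral_map (measurable_setLIntegral_count
    (measurable_setLIntegral_transport hφ _) measurableSet_Ioc) (measurable_shift _),
    meanTransport]
  refine lintegral_congr fun S => ?_
  simp_rw [hx, count_shift]
  rw [setLIntegral_Ioc_add_right S.count
    (fun t => ∫⁻ x in Ioc (j + n : ℝ) (j + 1 + n), transport φ S t x)
    ((measurable_setLIntegral_transport hφ _).comp (measurable_const.prodMk measurable_id))]
  push_cast
  simp_rw [add_right_comm]

theorem tsum_setLIntegral_Ioc (μ : Measure ℝ) (f : ℝ → ℝ≥0∞) :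
    ∑' n : ℤ, ∫⁻ t in Ioc (n : ℝ) (n + 1), f t ∂μ = ∫⁻ t, f t ∂μ := by
  rw [← lintegral_iUnion (fun _ => measurableSet_Ioc) (pairwise_disjoint_Ioc_intCast ℝ),
    iUnion_Ioc_intCast, setLIntegral_univ]

/-- Mass received by `(0, 1]`: by Tonelli it is the integral over `x` of the mean of `φ (S.waiting
x)`, which by stationarity does not depend on `x`. -/
theorem tsum_meanTransport_left {P : Measure PointConfig} [SFinite P] {φ : ℝ → ℝ≥0∞}
    (hφ : Measurable φ) (hP : IsTimeStationary P) (hnt : IsNonTransient P) :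
    ∑' i : ℤ, meanTransport P φ i 0 = ∫⁻ S, φ S.firstEvent ∂P := by
  unfold meanTransport
  rw [← lintegral_tsum fun i => (measurable_setLIntegral_count
    (measurable_setLIntegral_transport hφ _) measurableSet_Ioc).aemeasurable]
  have h1 : ∀ᵐ S ∂P, ∑' i : ℤ, ∫⁻ t in Ioc (i : ℝ) (i + 1),
      (∫⁻ x in Ioc ((0 : ℤ) : ℝ) ((0 : ℤ) + 1), transport φ S t x) ∂S.count
        = ∫⁻ x in Ioc 0 1, φ (S.waiting x) := by
    filter_upwards [hnt] with S hS
    rw [tsum_setLIntegral_Ioc, lintegral_lintegral_swap]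
    · simp_rw [lintegral_transport_left φ hS.1 hS.2]
      simp
    · exact ((measurable_transport hφ).comp
        ((measurable_const.prodMk measurable_fst).prodMk measurable_snd) : Measurable
          fun q : ℝ × ℝ => transport φ (S, q.1).1 (S, q.1).2 q.2).aemeasurable
  rw [lintegral_congr_ae h1, lintegral_lintegral_swap
    (f := fun (S : PointConfig) x => φ (S.waiting x)) (hφ.comp measurable_waiting).aemeasurable]
  have h2 : ∀ x : ℝ, ∫⁻ S, φ (S.waiting x) ∂P = ∫⁻ S, φ S.firstEvent ∂P := by
    intro x
    conv_rhs => rw [← hP x]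
    exact (lintegral_map (hφ.comp measurable_firstEvent) (measurable_shift x)).symm
  simp [h2]

/-- Mass sent from `(0, 1]`; the identity holds configuration by configuration. -/
theorem tsum_meanTransport_right (P : Measure PointConfig) {φ : ℝ → ℝ≥0∞} (hφ : Measurable φ) :
    ∑' j : ℤ, meanTransport P φ 0 j
      = ∫⁻ S, ∫⁻ t in Ioc 0 1, (∫⁻ y in Ioc 0 (S.waiting t), φ y) ∂S.count ∂P := by
  unfold meanTransport
  rw [← lintegral_tsum fun j => (measurable_setLIntegral_count
    (measurable_setLIntegral_transport hφ _) measurableSet_Ioc).aemeasurable]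
  refine lintegral_congr fun S => ?_
  have hm : ∀ j : ℤ, Measurable fun t => ∫⁻ x in Ioc (j : ℝ) (j + 1), transport φ S t x :=
    fun j => (measurable_setLIntegral_transport hφ _).comp
      (measurable_const (a := S) |>.prodMk measurable_id)
  rw [← lintegral_tsum fun j => (hm j).aemeasurable]
  simp_rw [tsum_setLIntegral_Ioc, lintegral_transport_right]
  simp

/-- The inversion formula: the time-stationary law of `T₁` in terms of the inter-event intervals
that start in `(0, 1]`. -/
theorem lintegral_firstEvent_eq {P : Measure PointConfig} [SFinite P] {φ : ℝ → ℝ≥0∞}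
    (hφ : Measurable φ) (hP : IsTimeStationary P) (hnt : IsNonTransient P) :
    ∫⁻ S, φ S.firstEvent ∂P
      = ∫⁻ S, ∫⁻ t in Ioc 0 1, (∫⁻ y in Ioc 0 (S.waiting t), φ y) ∂S.count ∂P := by
  rw [← tsum_meanTransport_left hφ hP hnt, ← tsum_meanTransport_right P hφ,
    -- What comes to block `0` from block `-j` equals what goes from block `0` to block `j`.
    ← (Equiv.neg ℤ).tsum_eq]
  refine tsum_congr fun j => ?_
  simpa using (meanTransport_add hP hφ (-j) 0 j).symm

/-! ### Moments of the first event under the Palm law -/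

theorem lintegral_eventStationary (P : Measure PointConfig) {f : PointConfig → ℝ≥0∞}
    (hf : Measurable f) :
    ∫⁻ S, f S ∂eventStationary P
      = (intensity P)⁻¹ * ∫⁻ S, ∫⁻ t in Ioc 0 1, f (S.shift t) ∂S.count ∂P := by
  rw [eventStationary, lintegral_smul_measure, smul_eq_mul,
    Measure.lintegral_bind measurable_seen.aemeasurable hf.aemeasurable]
  congr 1
  exact lintegral_congr fun S => lintegral_map hf S.measurable_shift_left

/-- With no events in `(0, 1]` nothing would be sent, yet for `φ = 1` the inversion formula requires
total mass `1`. -/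
theorem intensity_ne_zero {P : Measure PointConfig} [IsProbabilityMeasure P]
    (hP : IsTimeStationary P) (hnt : IsNonTransient P) : intensity P ≠ 0 := by
  intro h0
  rw [intensity, lintegral_eq_zero_iff (measurable_count_apply measurableSet_Ioc)] at h0
  have h := lintegral_firstEvent_eq (φ := fun _ => 1) measurable_const hP hnt
  have hz : ∀ᵐ S ∂P, ∫⁻ t in Ioc 0 1, (∫⁻ _ in Ioc 0 (S.waiting t), 1) ∂S.count = 0 := by
    filter_upwards [h0] with S hS
    rw [Measure.restrict_eq_zero.2 hS, lintegral_zero_measure]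
  rw [lintegral_congr_ae hz] at h
  simp at h

theorem isProbabilityMeasure_eventStationary {P : Measure PointConfig} (h0 : intensity P ≠ 0)
    (hfin : intensity P ≠ ∞) : IsProbabilityMeasure (eventStationary P) := by
  constructor
  rw [← lintegral_one, lintegral_eventStationary P measurable_const]
  simpa [intensity] using ENNReal.inv_mul_cancel h0 hfin

theorem meanFirst_eventStationary {P : Measure PointConfig} [IsProbabilityMeasure P]
    (hP : IsTimeStationary P) (hnt : IsNonTransient P) :
    meanFirst (eventStationary P) = (intensity P)⁻¹ := by
  rw [meanFirst, lintegral_eventStationary P measurable_firstEvent.ennreal_ofReal]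
  have h := lintegral_firstEvent_eq (φ := fun _ => 1) measurable_const hP hnt
  simp only [lintegral_one, Measure.restrict_apply_univ, Real.volume_Ioc, sub_zero,
    measure_univ] at h
  rw [show ∫⁻ S, ∫⁻ t in Ioc 0 1, ENNReal.ofReal (S.shift t).firstEvent ∂S.count ∂P = 1 from
    h.symm, mul_one]

theorem lintegral_Ioc_ofReal {a : ℝ} (ha : 0 ≤ a) :
    ∫⁻ y in Ioc 0 a, ENNReal.ofReal y = 2⁻¹ * ENNReal.ofReal a ^ 2 := by
  rw [← ofReal_integral_eq_lintegral_ofReal]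
  · rw [← intervalIntegral.integral_of_le ha, integral_id, ← ENNReal.ofReal_pow ha,
      show (a ^ 2 - 0 ^ 2) / 2 = 2⁻¹ * a ^ 2 by ring, ENNReal.ofReal_mul (by norm_num),
      ENNReal.ofReal_inv_of_pos (by norm_num)]
    simp
  · exact (continuous_id.integrableOn_Icc (a := 0) (b := a)).mono_set Ioc_subset_Icc_self
  · exact (ae_restrict_mem measurableSet_Ioc).mono fun y hy => hy.1.le

/-- The inversion formula with `φ y = y`, whose integral over `(0, w]` is `w² / 2`. Both sides may
be infinite. -/
theorem lintegral_sq_firstEvent_eventStationary {P : Measure PointConfig}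
    [IsProbabilityMeasure P] (hP : IsTimeStationary P) (hnt : IsNonTransient P) :
    ∫⁻ S, ENNReal.ofReal S.firstEvent ^ 2 ∂eventStationary P
      = 2 * (meanFirst (eventStationary P) * meanFirst P) := by
  have hm : Measurable fun S : PointConfig => ENNReal.ofReal S.firstEvent ^ 2 :=
    measurable_firstEvent.ennreal_ofReal.pow_const 2
  have h : meanFirst P = ∫⁻ S, ∫⁻ t in Ioc 0 1,
      2⁻¹ * ENNReal.ofReal (S.shift t).firstEvent ^ 2 ∂S.count ∂P := by
    rw [meanFirst, lintegral_firstEvent_eq ENNReal.measurable_ofReal hP hnt]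
    refine lintegral_congr fun S => lintegral_congr fun t => ?_
    exact lintegral_Ioc_ofReal (firstEvent_nonneg _)
  rw [meanFirst_eventStationary hP hnt, h, ← lintegral_eventStationary P (hm.const_mul _),
    lintegral_const_mul _ hm, ← mul_assoc, ENNReal.mul_inv_cancel (by simp) (by simp), one_mul]

/-- Layer-cake formula: the mean is the integral of the tail probabilities. -/
theorem meanFirst_le_of_dominates {P Q : Measure PointConfig}
    (h : FirstStochasticallyDominates P Q) : meanFirst Q ≤ meanFirst P := by
  rw [meanFirst, meanFirst,
    lintegral_eq_lintegral_meas_lt Q (.of_forall firstEvent_nonneg)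
      measurable_firstEvent.aemeasurable,
    lintegral_eq_lintegral_meas_lt P (.of_forall firstEvent_nonneg)
      measurable_firstEvent.aemeasurable]
  exact lintegral_mono fun t => h t

/-- A finite mean makes the real-valued expectation agree with `meanFirst`; an infinite second
moment then correctly gives infinite variance. -/
theorem evariance_firstEvent {Q : Measure PointConfig} [IsProbabilityMeasure Q]
    (hQ : meanFirst Q ≠ ∞) :
    evariance firstEvent Q
      = ∫⁻ S, ENNReal.ofReal S.firstEvent ^ 2 ∂Q - meanFirst Q ^ 2 := by
  rw [evariance_def' measurable_firstEvent.aestronglyMeasurable,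
    integral_eq_lintegral_of_nonneg_ae (.of_forall firstEvent_nonneg)
      measurable_firstEvent.aestronglyMeasurable,
    ENNReal.ofReal_pow ENNReal.toReal_nonneg]
  change _ - ENNReal.ofReal (meanFirst Q).toReal ^ 2 = _
  rw [ENNReal.ofReal_toReal hQ]
  simp_rw [Real.enorm_of_nonneg (firstEvent_nonneg _)]

end PointConfig

/-! ### Comparison of the means -/

theorem ENNReal.le_tsub_self_iff_two_mul_le {a b : ℝ≥0∞} (h0 : a ≠ 0) (h : a ≠ ∞) :
    a ≤ b - a ↔ 2 * a ≤ b := by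
  rw [two_mul]
  refine ⟨fun hle => ?_, fun hle => ENNReal.le_sub_of_add_le_right h hle⟩
  -- Positivity of `a` shows that the subtraction `b - a` is not truncated.
  have hab : a ≤ b := (tsub_pos_iff_lt.1 ((pos_iff_ne_zero.2 h0).trans_le hle)).le
  exact (ENNReal.le_sub_iff_add_le_right h hab).1 hle

theorem lemma1 (P : Measure PointConfig) [IsProbabilityMeasure P]
    (hstat : IsTimeStationary P) (hnt : IsNonTransient P) (hfin : intensity P ≠ ∞) :
    (0 < meanFirst (eventStationary P) ∧ meanFirst (eventStationary P) < ∞) ∧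
    (1 ≤ scvFirst (eventStationary P) ↔ meanFirst (eventStationary P) ≤ meanFirst P) ∧
    (FirstStochasticallyDominates P (eventStationary P) →
      1 ≤ scvFirst (eventStationary P)) := by
  have h0 := PointConfig.intensity_ne_zero hstat hnt
  have := PointConfig.isProbabilityMeasure_eventStationary h0 hfin
  have hmean := PointConfig.meanFirst_eventStationary hstat hnt
  have ha0 : meanFirst (eventStationary P) ≠ 0 := hmean ▸ ENNReal.inv_ne_zero.2 hfin
  have ha : meanFirst (eventStationary P) ≠ ∞ := hmean ▸ ENNReal.inv_ne_top.2 h0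
  have hiff : 1 ≤ scvFirst (eventStationary P) ↔
      meanFirst (eventStationary P) ≤ meanFirst P := by
    have hs0 : meanFirst (eventStationary P) ^ 2 ≠ 0 := pow_ne_zero 2 ha0
    have hs : meanFirst (eventStationary P) ^ 2 ≠ ∞ := ENNReal.pow_ne_top ha
    rw [scvFirst, ENNReal.le_div_iff_mul_le (.inl hs0) (.inl hs), one_mul,
      PointConfig.evariance_firstEvent ha, ENNReal.le_tsub_self_iff_two_mul_le hs0 hs,
      PointConfig.lintegral_sq_firstEvent_eventStationary hstat hnt,
      ENNReal.mul_le_mul_iff_right (by simp) (by simp), sq,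
      ENNReal.mul_le_mul_iff_right ha0 ha]
  exact ⟨⟨pos_iff_ne_zero.2 ha0, ha.lt_top⟩, hiff, fun h =>
    hiff.2 (PointConfig.meanFirst_le_of_dominates h)⟩
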